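/- Let $d\ge 1$, $p\in(1,\infty)$, $s\in(0,1)$, and let $\Omega\subset\mathbb{R}^d$ be a bounded domain (nonempty, open and connected). Let $$W^{1,p}_0(\Omega):=\{u\in L^p(\mathbb{R}^d):\ \nabla u\in L^p(\mathbb{R}^d),\ u=0 \text{ a.e. in } \mathbb{R}^d\setminus\Omega\},$$ where $\nabla u$ is the weak gradient of $u$ in $\mathbb{R}^d$. Let $u\in W^{1,p}_0(\Omega)$ satisfy $u\ge 0$ a.e., and assume that $u$ satisfies $\mathcal{L}^s_p u:=-\Delta_p u+(-\Delta_p)^s u\ge 0$ weakly in $\Omega$, that is, $$\int_{\Omega}|\nabla u(x)|^{p-2}\,\nabla u(x)\cdot\nabla\phi(x)\,dx+\int_{\mathbb{R}^d}\int_{\mathbb{R}^d}\frac{|u(x)-u(y)|^{p-2}(u(x)-u(y))}{|x-y|^{d+ps}}\,(\phi(x)-\phi(y))\,dy\,dx\ \ge\ 0$$ for every $\phi\in W^{1,p}_0(\Omega)$ with $\phi\ge 0$ a.e. (Here $|a|^{p-2}a:=0$ for $a=0$.) Then either $u=0$ a.e., or $u>0$ a.e. in $\Omega$. -/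

import Mathlib

open MeasureTheory
open scoped ContDiff

/-- `g` is the weak (distributional) gradient of `u` on `ℝ^d`: both are locally integrable and
`∫ u ∂_v φ = - ∫ (g ⬝ v) φ` for every direction `v` and every `φ ∈ C_c^∞(ℝ^d)`. -/
structure HasWeakGradient {d : ℕ} (u : EuclideanSpace ℝ (Fin d) → ℝ)
    (g : EuclideanSpace ℝ (Fin d) → EuclideanSpace ℝ (Fin d)) : Prop where
  locallyIntegrable : LocallyIntegrable u volume
  locallyIntegrable_grad : LocallyIntegrable g volume
  integral_eq : ∀ φ : EuclideanSpace ℝ (Fin d) → ℝ, ContDiff ℝ ∞ φ → HasCompactSupport φ →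
    ∀ v : EuclideanSpace ℝ (Fin d),
      ∫ x, u x * fderiv ℝ φ x v = - ∫ x, inner ℝ (g x) v * φ x

/-- The weak gradient is unique up to equality almost everywhere. -/
theorem HasWeakGradient.ae_eq {d : ℕ} {u : EuclideanSpace ℝ (Fin d) → ℝ}
    {g h : EuclideanSpace ℝ (Fin d) → EuclideanSpace ℝ (Fin d)}
    (hg : HasWeakGradient u g) (hh : HasWeakGradient u h) : g =ᵐ[volume] h := by
  have key : ∀ {k : EuclideanSpace ℝ (Fin d) → EuclideanSpace ℝ (Fin d)},
      LocallyIntegrable k volume → ∀ i, LocallyIntegrable (fun x => k x i) volume := by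
    intro k hk i x
    obtain ⟨s, hs, hks⟩ := hk x
    exact ⟨s, hs, (EuclideanSpace.proj (𝕜 := ℝ) i).integrable_comp hks⟩
  have hi : ∀ i, ∀ᵐ x ∂(volume : Measure (EuclideanSpace ℝ (Fin d))), g x i = h x i := by
    intro i
    refine ae_eq_of_integral_contDiff_smul_eq (key hg.locallyIntegrable_grad i)
      (key hh.locallyIntegrable_grad i) fun φ hφ hφc => ?_
    have e := (hg.integral_eq φ hφ hφc (EuclideanSpace.single i 1)).symm.trans
      (hh.integral_eq φ hφ hφc (EuclideanSpace.single i 1))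
    simpa [mul_comm, EuclideanSpace.inner_single_right] using e
  filter_upwards [ae_all_iff.2 hi] with x hx
  ext i
  exact hx i

open Classical in
/-- The weak gradient `∇u` on `ℝ^d` (a representative of it, well defined almost everywhere;
the value is `0` if `u` has no weak gradient). -/
noncomputable def weakGrad {d : ℕ} (u : EuclideanSpace ℝ (Fin d) → ℝ) :
    EuclideanSpace ℝ (Fin d) → EuclideanSpace ℝ (Fin d) :=
  if h : ∃ g, HasWeakGradient u g then h.choose else 0

theorem HasWeakGradient.hasWeakGradient_weakGrad {d : ℕ} {u : EuclideanSpace ℝ (Fin d) → ℝ}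
    {g : EuclideanSpace ℝ (Fin d) → EuclideanSpace ℝ (Fin d)} (hg : HasWeakGradient u g) :
    HasWeakGradient u (weakGrad u) := by
  have h : ∃ g, HasWeakGradient u g := ⟨g, hg⟩
  rw [weakGrad, dif_pos h]
  exact h.choose_spec

/-- `u ∈ W_0^{1,p}(Ω)`: `u ∈ L^p(ℝ^d)` has a weak gradient in `L^p(ℝ^d)`, and `u = 0` almost
everywhere in `ℝ^d \ Ω`. -/
structure MemW1p0 {d : ℕ} (p : ℝ) (Ω : Set (EuclideanSpace ℝ (Fin d)))
    (u : EuclideanSpace ℝ (Fin d) → ℝ) : Prop where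
  memLp : MemLp u (ENNReal.ofReal p) volume
  exists_weakGradient : ∃ g, HasWeakGradient u g
  memLp_grad : MemLp (weakGrad u) (ENNReal.ofReal p) volume
  eq_zero : ∀ᵐ x ∂(volume : Measure (EuclideanSpace ℝ (Fin d))), x ∉ Ω → u x = 0

/-- The form `⟨𝓛_p^s u, φ⟩`, where `𝓛_p^s = -Δ_p + (-Δ_p)^s`. -/
noncomputable def mixedForm {d : ℕ} (p s : ℝ) (Ω : Set (EuclideanSpace ℝ (Fin d)))
    (u φ : EuclideanSpace ℝ (Fin d) → ℝ) : ℝ :=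
  (∫ x in Ω, ‖weakGrad u x‖ ^ (p - 2) * inner ℝ (weakGrad u x) (weakGrad φ x)) +
    ∫ x, ∫ y, |u x - u y| ^ (p - 2) * (u x - u y) / ‖x - y‖ ^ ((d : ℝ) + p * s) * (φ x - φ y)

/-- `u` satisfies `𝓛_p^s u ≥ 0` weakly in `Ω`, tested with all nonnegative
`φ ∈ W_0^{1,p}(Ω)`. -/
def IsWeakSupersolution {d : ℕ} (p s : ℝ) (Ω : Set (EuclideanSpace ℝ (Fin d)))
    (u : EuclideanSpace ℝ (Fin d) → ℝ) : Prop :=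
  ∀ φ : EuclideanSpace ℝ (Fin d) → ℝ, MemW1p0 p Ω φ → 0 ≤ᵐ[volume] φ → 0 ≤ mixedForm p s Ω u φ

/-!
The nonlocal term alone forces positivity, so that neither a Harnack inequality nor the
connectedness of `Ω` is needed. Let `η` be smooth with `{η ≠ 0} = Ω` and `0 ≤ η ≤ 1`, and test the
inequality with `φₙ = η · hₙ(u)`, where `hₙ(t) = 1 / (1 + ((n + 1) t)²)` (`spike`) decreases on
`[0, ∞)` and tends to the indicator function of `{0}`.

* Local term. The part of `∇φₙ` along `∇u` has the coefficient `η hₙ'(u) ≤ 0`, and what remains is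
  at most `∫_Ω |∇u|^{p-2} ∇u · ∇η hₙ(u)`. By dominated convergence this tends to the integral over
  `{u = 0}`, where `∇u = 0` almost everywhere (`HasWeakGradient.ae_eq_zero_of_eq_zero`).
* Nonlocal term. Because `hₙ` is decreasing, the integrand `Gₙ` is at most the absolute value `D` of
  the integrand for the test function `η` (`nonlocal_mul_spike_le`), which is integrable. Its
  pointwise limit `G₀` is nonpositive, and it is negative at `(x, y)` if `x ∈ Ω`,
  `u x = 0 < u y`.

Fatou's lemma for `D - Gₙ ≥ 0` (`ae_eq_zero_of_tendsto_of_le`) gives `G₀ = 0` almost everywhere,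
so the product of `{u = 0} ∩ Ω` and `{u > 0}` is a null set, and one of the factors is null.

The Sobolev theory behind this rests on the identity `u(x + h) - u(x) = ∫₀¹ ∇u(x + th) · h dt` for
almost every `x` (`HasWeakGradient.translate_sub_ae_eq`). It makes the difference quotients converge
in `L¹`, which gives the chain rule for `hₙ(u)` (`HasWeakGradient.comp`), and it bounds
`‖u(· + h) - u‖_p` by `|h| ‖∇u‖_p`, which makes the Gagliardo seminorm finite
(`MemW1p0.integrable_gagliardo`); the latter gives the integrability that the nonlocal form needs.
-/

/-! ### Translations and weak gradients -/

section Translation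
open Filter Topology

/-- Translations act continuously on `L¹`. -/
theorem tendsto_integral_norm_translate_sub {E F : Type*} [NormedAddCommGroup E]
    [NormedSpace ℝ E] [FiniteDimensional ℝ E] [MeasurableSpace E] [BorelSpace E]
    [NormedAddCommGroup F] {μ : Measure E} [μ.IsAddHaarMeasure] {f : E → F}
    (hf : Integrable f μ) :
    Tendsto (fun h : E => ∫ x, ‖f (x + h) - f x‖ ∂μ) (𝓝 0) (𝓝 0) := by
  have hm : MemLp f 1 μ := memLp_one_iff_integrable.2 hf
  let τ : E → C(E, E) := fun h => ⟨fun x => x + h, by fun_prop⟩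
  have hτ : ∀ h, MeasurePreserving (τ h) μ μ := fun h => measurePreserving_add_right μ h
  have hτc : Continuous τ :=
    ((ContinuousMap.mk (fun a : E × E => a.2 + a.1) (by fun_prop)).curry).continuous
  have hc : Continuous fun h : E => Lp.compMeasurePreserving (τ h) (hτ h) (hm.toLp f) :=
    continuous_const.compMeasurePreservingLp hτc hτ ENNReal.one_ne_top
  have key : ∀ h : E, ‖Lp.compMeasurePreserving (τ h) (hτ h) (hm.toLp f) - hm.toLp f‖ =
      ∫ x, ‖f (x + h) - f x‖ ∂μ := by
    intro h
    rw [Lp.toLp_compMeasurePreserving, ← MemLp.toLp_sub, Lp.norm_toLp,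
      eLpNorm_one_eq_lintegral_enorm, ← integral_norm_eq_lintegral_enorm
        ((hm.comp_measurePreserving (hτ h)).sub hm).aestronglyMeasurable]
    rfl
  have h0 := (hc.sub continuous_const).norm.tendsto (x := (0 : E))
    (f := fun h : E => ‖Lp.compMeasurePreserving (τ h) (hτ h) (hm.toLp f) - hm.toLp f‖)
  simp only [key] at h0
  simpa using h0

theorem integrable_prod_translate {E F : Type*} [NormedAddCommGroup E]
    [NormedSpace ℝ E] [FiniteDimensional ℝ E] [MeasurableSpace E] [BorelSpace E]
    [NormedAddCommGroup F] {μ : Measure E} [μ.IsAddHaarMeasure] (ν : Measure ℝ)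
    [IsFiniteMeasure ν] {f : E → F} (hf : Integrable f μ) (h : E) :
    Integrable (fun z : E × ℝ => f (z.1 + z.2 • h)) (μ.prod ν) := by
  have hpres : MeasurePreserving (fun z : E × ℝ => (z.1 + z.2 • h, z.2))
      (μ.prod ν) (μ.prod ν) := by
    have : MeasurePreserving (fun z : ℝ × E => (z.1, z.2 + z.1 • h))
      (ν.prod μ) (ν.prod μ) := by
      refine (MeasurePreserving.id ν).skew_product (g := fun t x => x + t • h) ?_ ?_
      · fun_prop
      · exact Eventually.of_forall fun t => (measurePreserving_add_right μ (t • h)).map_eq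
    exact (Measure.measurePreserving_swap.comp this).comp Measure.measurePreserving_swap
  exact hpres.integrable_comp_of_integrable (hf.comp_fst ν)

variable {d : ℕ}

/-- The fundamental theorem of calculus along a segment, for weak gradients. It is checked
against test functions: after a change of variables the increment falls on the test function, and
Fubini's theorem applies. -/
theorem HasWeakGradient.translate_sub_ae_eq {u : EuclideanSpace ℝ (Fin d) → ℝ}
    {g : EuclideanSpace ℝ (Fin d) → EuclideanSpace ℝ (Fin d)} (hg : HasWeakGradient u g)
    (hui : Integrable u) (hgi : Integrable g) (h : EuclideanSpace ℝ (Fin d)) :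
    ∀ᵐ x, u (x + h) - u x = ∫ t in Set.Ioc (0 : ℝ) 1, inner ℝ (g (x + t • h)) h := by
  set ν : Measure ℝ := volume.restrict (Set.Ioc (0 : ℝ) 1) with hν
  have hGprod : Integrable (fun z : EuclideanSpace ℝ (Fin d) × ℝ =>
      inner ℝ (g (z.1 + z.2 • h)) h) (volume.prod ν) :=
    integrable_prod_translate ν (f := fun x => (inner ℝ (g x) h : ℝ)) (hgi.inner_const h) h
  refine ae_eq_of_integral_contDiff_smul_eq
    ((hui.comp_add_right h).sub hui).locallyIntegrable
    hGprod.integral_prod_left.locallyIntegrable fun φ hφ hφc => ?_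
  have hφcont := hφ.continuous
  obtain ⟨C, hC⟩ := hφc.exists_bound_of_continuous hφcont
  have hdcont : Continuous fun x => fderiv ℝ φ x h :=
    (hφ.continuous_fderiv (by simp)).clm_apply continuous_const
  have hdc : HasCompactSupport fun x => fderiv ℝ φ x h := hφc.fderiv_apply (𝕜 := ℝ) h
  obtain ⟨D, hD⟩ := hdc.exists_bound_of_continuous hdcont
  have huφ : Integrable fun x => φ x * u x :=
    hui.bdd_mul hφcont.aestronglyMeasurable (Eventually.of_forall hC)
  have huφ' : Integrable fun x => φ x * u (x + h) :=
    (hui.comp_add_right h).bdd_mul hφcont.aestronglyMeasurable (Eventually.of_forall hC)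
  have huφ2 : Integrable fun x => φ (x - h) * u x :=
    hui.bdd_mul (by fun_prop) (Eventually.of_forall fun x => hC (x - h))
  have ftc : ∀ x, φ (x - h) - φ x = - ∫ t, fderiv ℝ φ (x - t • h) h ∂ν := by
    intro x
    have hder : ∀ t : ℝ, HasDerivAt (fun t : ℝ => φ (x - t • h))
        (-(fderiv ℝ φ (x - t • h) h)) t := by
      intro t
      have h1 : HasDerivAt (fun t : ℝ => x - t • h) (-h) t := by
        simpa using ((hasDerivAt_id t).smul_const h).const_sub x
      have h2 := ((hφ.differentiable (by simp)) (x - t • h)).hasFDerivAt.comp_hasDerivAt t h1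
      simpa [Function.comp_def] using h2
    have := intervalIntegral.integral_eq_sub_of_hasDerivAt (a := 0) (b := 1)
      (fun t _ => hder t) (Continuous.intervalIntegrable (by fun_prop) _ _)
    rw [intervalIntegral.integral_of_le zero_le_one, integral_neg] at this
    simpa using this.symm
  simp only [smul_eq_mul]
  calc ∫ x, φ x * (u (x + h) - u x) = (∫ x, φ x * u (x + h)) - ∫ x, φ x * u x := by
        rw [← integral_sub huφ' huφ]; simp only [mul_sub]
    _ = (∫ x, φ (x - h) * u x) - ∫ x, φ x * u x := by
        rw [← integral_add_right_eq_self (fun x => φ (x - h) * u x) h]; simp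
    _ = ∫ x, (∫ t, -(fderiv ℝ φ (x - t • h) h * u x) ∂ν) := by
        rw [← integral_sub huφ2 huφ]
        refine integral_congr_ae (Eventually.of_forall fun x => ?_)
        simp only
        rw [← sub_mul, ftc, integral_neg, integral_mul_const, neg_mul]
    _ = ∫ t, (∫ x, -(fderiv ℝ φ (x - t • h) h * u x)) ∂ν := by
        refine integral_integral_swap (f := fun x t => -(fderiv ℝ φ (x - t • h) h * u x))
          (Integrable.neg (f := fun z : EuclideanSpace ℝ (Fin d) × ℝ =>
            fderiv ℝ φ (z.1 - z.2 • h) h * u z.1) ?_)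
        refine (hui.comp_fst ν).bdd_mul (c := D) ?_ (Eventually.of_forall fun z => hD _)
        exact Continuous.aestronglyMeasurable (by fun_prop)
    _ = ∫ t, (∫ x, φ x * inner ℝ (g (x + t • h)) h) ∂ν := by
        refine integral_congr_ae (Eventually.of_forall fun t => ?_)
        simp only
        have := hg.integral_eq (fun x => φ (x - t • h)) (by fun_prop)
          (by simpa [sub_eq_add_neg, Function.comp_def] using
            hφc.comp_homeomorph (Homeomorph.addRight (-(t • h)))) h
        simp only [fderiv_comp_sub] at this
        rw [integral_neg]
        simp only [mul_comm _ (u _)]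
        rw [this, neg_neg, ← integral_add_right_eq_self _ (t • h)]
        simp [mul_comm]
    _ = ∫ x, (∫ t, φ x * inner ℝ (g (x + t • h)) h ∂ν) := by
        refine (integral_integral_swap ?_).symm
        exact hGprod.bdd_mul (c := C) (Continuous.aestronglyMeasurable (by fun_prop))
          (Eventually.of_forall fun z => hC _)
    _ = _ := by simp only [integral_const_mul]

end Translation

/-! ### Chain rule for weak gradients -/

section ChainRule
open Filter Topology

variable {d : ℕ}

/-- Difference quotients converge in `L¹` to the weak directional derivative, because they are
means of translates of it. -/
theorem HasWeakGradient.tendsto_integral_abs_difference_quotient_sub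
    {u : EuclideanSpace ℝ (Fin d) → ℝ}
    {g : EuclideanSpace ℝ (Fin d) → EuclideanSpace ℝ (Fin d)} (hg : HasWeakGradient u g)
    (hui : Integrable u) (hgi : Integrable g) (v : EuclideanSpace ℝ (Fin d)) :
    Tendsto (fun t : ℝ => ∫ x, |(u (x + t • v) - u x) / t - inner ℝ (g x) v|) (𝓝[≠] 0) (𝓝 0) := by
  set G : EuclideanSpace ℝ (Fin d) → ℝ := fun x => inner ℝ (g x) v with hG
  have hGi : Integrable G := hgi.inner_const v
  set ν : Measure ℝ := volume.restrict (Set.Ioc (0 : ℝ) 1) with hν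
  have hbound : ∀ t : ℝ, t ≠ 0 → ∫ x, |(u (x + t • v) - u x) / t - G x| ≤
      ∫ s, (∫ x, ‖G (x + s • (t • v)) - G x‖) ∂ν := by
    intro t ht
    have hprod : Integrable (fun z : EuclideanSpace ℝ (Fin d) × ℝ =>
        ‖G (z.1 + z.2 • (t • v)) - G z.1‖) (volume.prod ν) :=
      ((integrable_prod_translate ν hGi (t • v)).sub (hGi.comp_fst ν)).norm
    rw [← integral_integral_swap hprod]
    refine integral_mono_ae ?_ hprod.integral_prod_left ?_
    · exact (((((hui.comp_add_right _).sub hui).div_const t).sub hGi).abs)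
    filter_upwards [hg.translate_sub_ae_eq hui hgi (t • v),
      (integrable_prod_translate ν hGi (t • v)).prod_right_ae] with x hx hxi
    have e : (u (x + t • v) - u x) / t - G x = ∫ s, (G (x + s • (t • v)) - G x) ∂ν := by
      rw [integral_sub hxi (integrable_const _), hx]
      simp only [inner_smul_right, integral_const_mul, hG]
      rw [mul_div_cancel_left₀ _ ht]
      simp [hν]
    simp only [e]
    exact norm_integral_le_integral_norm (μ := ν) fun s => G (x + s • (t • v)) - G x
  rw [Metric.tendsto_nhds]
  intro ε hε
  obtain ⟨δ, hδ, hδω⟩ := Metric.eventually_nhds_iff.1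
    ((tendsto_integral_norm_translate_sub hGi).eventually (gt_mem_nhds (half_pos hε)))
  have hsmall : ∀ᶠ t : ℝ in 𝓝[≠] 0, ‖t • v‖ < δ := by
    have : Tendsto (fun t : ℝ => ‖t • v‖) (𝓝[≠] 0) (𝓝 0) := by
      have h : Continuous fun t : ℝ => ‖t • v‖ := by fun_prop
      simpa using (h.tendsto 0).mono_left nhdsWithin_le_nhds
    exact this.eventually (gt_mem_nhds hδ)
  filter_upwards [hsmall, self_mem_nhdsWithin] with t ht ht0
  rw [Real.dist_eq, sub_zero, abs_of_nonneg (integral_nonneg fun _ => abs_nonneg _)]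
  refine (hbound t ht0).trans_lt (lt_of_le_of_lt ?_ (half_lt_self hε))
  have hle : ∀ᵐ s ∂ν, ‖∫ x, ‖G (x + s • (t • v)) - G x‖‖ ≤ ε / 2 := by
    rw [hν]
    filter_upwards [ae_restrict_mem measurableSet_Ioc] with s hs
    rw [Real.norm_of_nonneg (integral_nonneg fun _ => norm_nonneg _)]
    refine (hδω ?_).le
    rw [dist_zero_right, norm_smul, Real.norm_of_nonneg hs.1.le]
    exact (mul_le_of_le_one_left (norm_nonneg _) hs.2).trans_lt ht
  refine (le_abs_self _).trans ((norm_integral_le_of_norm_le_const hle).trans ?_)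
  simp [hν]

/-- The secant slope of a `C¹` function is the mean of the derivative along the segment, hence
jointly continuous in the two end points. -/
theorem ContDiff.exists_continuous_slope {F : ℝ → ℝ} (hF : ContDiff ℝ 1 F) {C : ℝ}
    (hC : ∀ t, |deriv F t| ≤ C) :
    ∃ c : ℝ × ℝ → ℝ, Continuous c ∧ (∀ z, |c z| ≤ C) ∧ (∀ a, c (a, a) = deriv F a) ∧
      ∀ a b, F b - F a = c (a, b) * (b - a) := by
  have hF' : Continuous (deriv F) := hF.continuous_deriv le_rfl
  refine ⟨fun z => ∫ s in (0 : ℝ)..1, deriv F (z.1 + s * (z.2 - z.1)), ?_, ?_, ?_, ?_⟩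
  · refine intervalIntegral.continuous_parametric_intervalIntegral_of_continuous' ?_ _ _
    simp only [Function.uncurry_def]
    fun_prop
  · intro z
    have := intervalIntegral.norm_integral_le_of_norm_le_const (a := (0 : ℝ)) (b := 1) (C := C)
      (f := fun s => deriv F (z.1 + s * (z.2 - z.1))) (fun s _ => hC _)
    simpa using this
  · intro a
    simp
  · intro a b
    have hder : ∀ s : ℝ, HasDerivAt (fun s : ℝ => F (a + s * (b - a)))
        (deriv F (a + s * (b - a)) * (b - a)) s := by
      intro s
      have h1 : HasDerivAt (fun s : ℝ => a + s * (b - a)) (b - a) s := by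
        simpa using ((hasDerivAt_id s).mul_const (b - a)).const_add a
      exact ((hF.differentiable one_ne_zero _).hasDerivAt).comp s h1
    have := intervalIntegral.integral_eq_sub_of_hasDerivAt (a := 0) (b := 1)
      (fun s _ => hder s) (Continuous.intervalIntegrable (by fun_prop) _ _)
    rw [intervalIntegral.integral_mul_const] at this
    simp only [one_mul, zero_mul, add_zero, add_sub_cancel] at this
    exact this.symm

theorem integral_fderiv_apply_eq_zero {φ : EuclideanSpace ℝ (Fin d) → ℝ} (hφ : ContDiff ℝ ∞ φ)
    (hφc : HasCompactSupport φ) (v : EuclideanSpace ℝ (Fin d)) : ∫ x, fderiv ℝ φ x v = 0 := by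
  have hdcont : Continuous fun x => fderiv ℝ φ x v :=
    (hφ.continuous_fderiv (by simp)).clm_apply continuous_const
  have hdc : HasCompactSupport fun x => fderiv ℝ φ x v := hφc.fderiv_apply (𝕜 := ℝ) v
  have := integral_mul_fderiv_eq_neg_fderiv_mul_of_integrable (𝕜 := ℝ)
    (μ := (volume : Measure (EuclideanSpace ℝ (Fin d))))
    (f := fun _ => (1 : ℝ)) (g := φ) (v := v) (by simp)
    (by simpa using hdcont.integrable_of_hasCompactSupport hdc)
    (by simpa using hφ.continuous.integrable_of_hasCompactSupport hφc)
    (fun x _ => by fun_prop) (fun x _ => (hφ.differentiable (by simp)) x)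
  simpa using this

/-- Difference quotients may be moved onto the test function, in the limit: this is integration
by parts for the derivative of a test function. -/
theorem tendsto_integral_mul_difference_quotient {w φ : EuclideanSpace ℝ (Fin d) → ℝ}
    (hw : Integrable w) (hφ : ContDiff ℝ ∞ φ) (hφc : HasCompactSupport φ)
    (v : EuclideanSpace ℝ (Fin d)) :
    Tendsto (fun t : ℝ => ∫ x, φ x * ((w (x + t • v) - w x) / t)) (𝓝[≠] 0)
      (𝓝 (- ∫ x, w x * fderiv ℝ φ x v)) := by
  have hφcont := hφ.continuous
  obtain ⟨C, hC⟩ := hφc.exists_bound_of_continuous hφcont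
  have hdcont : Continuous fun x => fderiv ℝ φ x v :=
    (hφ.continuous_fderiv (by simp)).clm_apply continuous_const
  have hdc : HasCompactSupport fun x => fderiv ℝ φ x v := hφc.fderiv_apply (𝕜 := ℝ) v
  obtain ⟨D, hD⟩ := hdc.exists_bound_of_continuous hdcont
  have hder : ∀ x (t : ℝ), HasDerivAt (fun t : ℝ => φ (x - t • v))
      (-(fderiv ℝ φ (x - t • v) v)) t := by
    intro x t
    have h1 : HasDerivAt (fun t : ℝ => x - t • v) (-v) t := by
      simpa using ((hasDerivAt_id t).smul_const v).const_sub x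
    have h2 := ((hφ.differentiable (by simp)) (x - t • v)).hasFDerivAt.comp_hasDerivAt t h1
    simpa [Function.comp_def] using h2
  have e : ∀ t : ℝ, ∫ x, φ x * ((w (x + t • v) - w x) / t) =
      ∫ x, w x * ((φ (x - t • v) - φ x) / t) := by
    intro t
    have i1 : Integrable fun x => φ x * w x :=
      hw.bdd_mul hφcont.aestronglyMeasurable (Eventually.of_forall hC)
    have i2 : Integrable fun x => φ x * w (x + t • v) :=
      (hw.comp_add_right _).bdd_mul hφcont.aestronglyMeasurable (Eventually.of_forall hC)
    have i3 : Integrable fun x => φ (x - t • v) * w x :=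
      hw.bdd_mul (by fun_prop) (Eventually.of_forall fun x => hC _)
    have : (∫ x, φ x * w (x + t • v)) - ∫ x, φ x * w x =
        (∫ x, φ (x - t • v) * w x) - ∫ x, φ x * w x := by
      rw [← integral_add_right_eq_self (fun x => φ (x - t • v) * w x) (t • v)]; simp
    rw [← integral_sub i2 i1, ← integral_sub i3 i1] at this
    simp only [← mul_div_assoc, integral_div, mul_sub]
    rw [this]
    simp only [mul_comm]
  simp only [e]
  rw [← integral_neg]
  refine tendsto_integral_filter_of_dominated_convergence (fun x => D * ‖w x‖) ?_ ?_
    (hw.norm.const_mul D) ?_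
  · refine Eventually.of_forall fun t => hw.aestronglyMeasurable.mul ?_
    exact Continuous.aestronglyMeasurable (by fun_prop)
  · filter_upwards [self_mem_nhdsWithin] with t ht
    refine Eventually.of_forall fun x => ?_
    rw [norm_mul, mul_comm]
    refine mul_le_mul_of_nonneg_right ?_ (norm_nonneg _)
    have := Convex.norm_image_sub_le_of_norm_hasDerivWithin_le (C := D) (s := Set.univ)
      (fun s _ => (hder x s).hasDerivWithinAt) (fun s _ => by simpa using hD (x - s • v)) convex_univ
      (Set.mem_univ 0) (Set.mem_univ t)
    rw [norm_div, div_le_iff₀ (norm_pos_iff.2 ht)]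
    simpa using this
  · refine Eventually.of_forall fun x => ?_
    have := (hasDerivAt_iff_tendsto_slope.1 (hder x 0)).const_mul (w x)
    simpa [slope_def_field] using this

/-- Chain rule for weak gradients, for an outer function of class `C¹` with bounded derivative. -/
theorem HasWeakGradient.comp {u : EuclideanSpace ℝ (Fin d) → ℝ}
    {g : EuclideanSpace ℝ (Fin d) → EuclideanSpace ℝ (Fin d)} (hg : HasWeakGradient u g)
    (hui : Integrable u) (hgi : Integrable g) {F : ℝ → ℝ} (hF : ContDiff ℝ 1 F) {C : ℝ}
    (hC : ∀ t, |deriv F t| ≤ C) :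
    HasWeakGradient (fun x => F (u x)) (fun x => deriv F (u x) • g x) := by
  have hF' : Continuous (deriv F) := hF.continuous_deriv le_rfl
  obtain ⟨c, hc, hcC, hcd, hcs⟩ := hF.exists_continuous_slope hC
  -- Only `F ∘ u - F 0` is integrable; the constant `F 0` is dealt with at the end.
  have hw : Integrable fun x => F (u x) - F 0 := by
    have : (fun x => F (u x) - F 0) = fun x => c (0, u x) * u x := by
      ext x; simpa using hcs 0 (u x)
    rw [this]
    refine hui.bdd_mul (c := C) ?_ (Eventually.of_forall fun x => hcC _)
    exact (hc.comp (by fun_prop : Continuous fun a : ℝ => ((0 : ℝ), a))).comp_aestronglyMeasurable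
      hui.aestronglyMeasurable
  have hwloc : LocallyIntegrable fun x => F (u x) := by
    refine (hw.locallyIntegrable.add (locallyIntegrable_const (F 0))).congr ?_
    exact Eventually.of_forall fun x => sub_add_cancel _ _
  refine ⟨hwloc, ?_, fun φ hφ hφc v => ?_⟩
  · exact (hgi.bdd_smul C (hF'.comp_aestronglyMeasurable hui.aestronglyMeasurable)
      (Eventually.of_forall fun x => hC _)).locallyIntegrable
  have hφcont := hφ.continuous
  obtain ⟨M, hM⟩ := hφc.exists_bound_of_continuous hφcont
  have hdcont : Continuous fun x => fderiv ℝ φ x v :=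
    (hφ.continuous_fderiv (by simp)).clm_apply continuous_const
  have hdc : HasCompactSupport fun x => fderiv ℝ φ x v := hφc.fderiv_apply (𝕜 := ℝ) v
  set G : EuclideanSpace ℝ (Fin d) → ℝ := fun x => inner ℝ (g x) v with hG
  have hGi : Integrable G := hgi.inner_const v
  -- Along a suitable sequence of increments the translates of `u` converge almost everywhere.
  obtain ⟨t, ht, hae⟩ : ∃ t : ℕ → ℝ, Tendsto t atTop (𝓝[≠] 0) ∧
      ∀ᵐ x, Tendsto (fun k => u (x + t k • v)) atTop (𝓝 (u x)) := by
    have h1 : Tendsto (fun t : ℝ => ∫ x, ‖u (x + t • v) - u x‖) (𝓝[≠] 0) (𝓝 0) := by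
      have hcv : Tendsto (fun t : ℝ => t • v) (𝓝[≠] 0) (𝓝 0) := by
        have h : Continuous fun t : ℝ => t • v := by fun_prop
        simpa using (h.tendsto 0).mono_left nhdsWithin_le_nhds
      exact (tendsto_integral_norm_translate_sub hui).comp hcv
    refine TendstoInMeasure.exists_seq_tendsto_ae' (f := fun (t : ℝ) x => u (x + t • v)) ?_
    refine tendstoInMeasure_of_tendsto_eLpNorm one_ne_zero
      (fun t => (hui.comp_add_right (t • v)).aestronglyMeasurable) hui.aestronglyMeasurable ?_
    have h2 := ENNReal.tendsto_ofReal h1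
    rw [ENNReal.ofReal_zero] at h2
    refine h2.congr fun t => ?_
    rw [eLpNorm_one_eq_lintegral_enorm]
    exact ofReal_integral_norm_eq_lintegral_enorm ((hui.comp_add_right (t • v)).sub hui)
  have L1 := (tendsto_integral_mul_difference_quotient hw hφ hφc v).comp ht
  have hcm : ∀ k, AEStronglyMeasurable (fun x => c (u x, u (x + t k • v))) := fun k =>
    hc.comp_aestronglyMeasurable
      (hui.aestronglyMeasurable.prodMk (hui.comp_add_right (t k • v)).aestronglyMeasurable)
  have hφcm : ∀ k, AEStronglyMeasurable (fun x => φ x * c (u x, u (x + t k • v))) := fun k =>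
    hφcont.aestronglyMeasurable.mul (hcm k)
  have hφcb : ∀ k x, ‖φ x * c (u x, u (x + t k • v))‖ ≤ M * C := fun k x => by
    rw [norm_mul]
    exact mul_le_mul (hM x) (hcC _) (norm_nonneg _) ((norm_nonneg _).trans (hM x))
  set r : ℕ → EuclideanSpace ℝ (Fin d) → ℝ :=
    fun k x => (u (x + t k • v) - u x) / t k - G x with hr
  have hri : ∀ k, Integrable (r k) := fun k =>
    (((hui.comp_add_right _).sub hui).div_const _).sub hGi
  -- The difference quotient of `F ∘ u` is `c` times that of `u`. The latter is split into its `L¹`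
  -- limit `G` and a remainder `r` that is small in `L¹`.
  have L2 : Tendsto (fun k => ∫ x, φ x * c (u x, u (x + t k • v)) * r k x) atTop (𝓝 0) := by
    have h0 := ((hg.tendsto_integral_abs_difference_quotient_sub hui hgi v).comp ht).const_mul
      (M * C)
    rw [mul_zero] at h0
    refine squeeze_zero_norm (fun k => ?_) h0
    refine (norm_integral_le_integral_norm _).trans ?_
    simp only [Function.comp]
    rw [← integral_const_mul]
    refine integral_mono ((hri k).bdd_mul (hφcm k) (Eventually.of_forall (hφcb k))).norm
      ((hri k).abs.const_mul _) fun x => ?_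
    simp only
    rw [norm_mul]
    exact mul_le_mul_of_nonneg_right (hφcb k x) (norm_nonneg _)
  have L3 : Tendsto (fun k => ∫ x, φ x * c (u x, u (x + t k • v)) * G x) atTop
      (𝓝 (∫ x, φ x * deriv F (u x) * G x)) := by
    refine tendsto_integral_of_dominated_convergence (fun x => M * C * ‖G x‖)
      (fun k => (hφcm k).mul hGi.aestronglyMeasurable) (hGi.norm.const_mul _) ?_ ?_
    · refine fun k => Eventually.of_forall fun x => ?_
      rw [norm_mul]
      exact mul_le_mul_of_nonneg_right (hφcb k x) (norm_nonneg _)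
    · filter_upwards [hae] with x hx
      have : Tendsto (fun k => c (u x, u (x + t k • v))) atTop (𝓝 (c (u x, u x))) :=
        (hc.tendsto _).comp (tendsto_const_nhds.prodMk_nhds hx)
      rw [hcd] at this
      exact (this.const_mul _).mul_const _
  have L4 := L2.add L3
  rw [zero_add] at L4
  have hlim := tendsto_nhds_unique (L1.congr fun k => ?_) L4
  · rw [integral_congr_ae (g := fun x => (F (u x) - F 0) * fderiv ℝ φ x v
      + F 0 * fderiv ℝ φ x v) (Eventually.of_forall fun x => by ring)]
    obtain ⟨D, hD⟩ := hdc.exists_bound_of_continuous hdcont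
    rw [integral_add (hw.mul_bdd hdcont.aestronglyMeasurable (Eventually.of_forall hD))
      ((hdcont.integrable_of_hasCompactSupport hdc).const_mul _), integral_const_mul,
      integral_fderiv_apply_eq_zero hφ hφc v, mul_zero, add_zero, ← neg_eq_iff_eq_neg, hlim]
    refine integral_congr_ae (Eventually.of_forall fun x => ?_)
    simp only [inner_smul_left, hG]
    simp
    ring
  · have i1 := (hri k).bdd_mul (hφcm k) (Eventually.of_forall (hφcb k))
    have i2 := hGi.bdd_mul (hφcm k) (Eventually.of_forall (hφcb k))
    simp only [Function.comp]
    rw [← integral_add i1 i2]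
    refine integral_congr_ae (Eventually.of_forall fun x => ?_)
    simp only [hr]
    rw [sub_sub_sub_cancel_right, hcs (u x)]
    ring

end ChainRule

/-! ### Product with a smooth function -/

section ProductRule
open Filter Topology

variable {d : ℕ}

theorem continuous_gradient_of_contDiff {η : EuclideanSpace ℝ (Fin d) → ℝ} (hη : ContDiff ℝ ∞ η) :
    Continuous (gradient η) :=
  (LinearIsometryEquiv.continuous _).comp (hη.continuous_fderiv (by simp))

theorem hasCompactSupport_gradient {η : EuclideanSpace ℝ (Fin d) → ℝ}
    (hηc : HasCompactSupport η) : HasCompactSupport (gradient η) :=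
  (hηc.fderiv (𝕜 := ℝ)).comp_left (map_zero _)

theorem HasWeakGradient.smooth_mul {v : EuclideanSpace ℝ (Fin d) → ℝ}
    {g : EuclideanSpace ℝ (Fin d) → EuclideanSpace ℝ (Fin d)} (hg : HasWeakGradient v g)
    {η : EuclideanSpace ℝ (Fin d) → ℝ} (hη : ContDiff ℝ ∞ η) (hηc : HasCompactSupport η) :
    HasWeakGradient (fun x => η x * v x) (fun x => η x • g x + v x • gradient η x) := by
  have i1 := hg.locallyIntegrable_grad.integrable_smul_left_of_hasCompactSupport hη.continuous hηc
  have i2 := hg.locallyIntegrable.integrable_smul_right_of_hasCompactSupport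
    (continuous_gradient_of_contDiff hη) (hasCompactSupport_gradient hηc)
  refine ⟨(hg.locallyIntegrable.integrable_smul_left_of_hasCompactSupport hη.continuous
    hηc).locallyIntegrable, (i1.add i2).locallyIntegrable, fun ψ hψ hψc w => ?_⟩
  have hψη : ContDiff ℝ ∞ (fun x => η x * ψ x) := hη.mul hψ
  have hψηc : HasCompactSupport (fun x => η x * ψ x) := hψc.mul_left
  have hfd : ∀ x, fderiv ℝ (fun x => η x * ψ x) x w =
      η x * fderiv ℝ ψ x w + ψ x * fderiv ℝ η x w := by
    intro x
    rw [fderiv_fun_mul (hη.differentiable (by simp) x) (hψ.differentiable (by simp) x)]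
    simp
  have key := hg.integral_eq _ hψη hψηc w
  simp only [hfd] at key
  obtain ⟨M, hM⟩ := hψc.exists_bound_of_continuous hψ.continuous
  have c1 : Continuous fun x => fderiv ℝ ψ x w :=
    (hψ.continuous_fderiv (by simp)).clm_apply continuous_const
  have c2 : Continuous fun x => fderiv ℝ η x w :=
    (hη.continuous_fderiv (by simp)).clm_apply continuous_const
  have j1 : Integrable fun x => v x * (η x * fderiv ℝ ψ x w) :=
    hg.locallyIntegrable.integrable_smul_right_of_hasCompactSupport
      (hη.continuous.mul c1) hηc.mul_right
  have j2 : Integrable fun x => v x * (ψ x * fderiv ℝ η x w) :=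
    hg.locallyIntegrable.integrable_smul_right_of_hasCompactSupport
      (hψ.continuous.mul c2) hψc.mul_right
  have j3 : Integrable fun x => inner ℝ (g x) w * (η x * ψ x) := by
    have := (i1.inner_const (𝕜 := ℝ) w).mul_bdd hψ.continuous.aestronglyMeasurable
      (Eventually.of_forall hM)
    refine this.congr (Eventually.of_forall fun x => ?_)
    simp only [inner_smul_left]
    simp
    ring
  simp only [mul_add] at key
  rw [integral_add j1 j2] at key
  calc ∫ x, η x * v x * fderiv ℝ ψ x w = ∫ x, v x * (η x * fderiv ℝ ψ x w) := by
        refine integral_congr_ae (Eventually.of_forall fun x => ?_)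
        simp only; ring
    _ = -((∫ x, inner ℝ (g x) w * (η x * ψ x)) + ∫ x, v x * (ψ x * fderiv ℝ η x w)) := by
        linarith
    _ = _ := by
        rw [← integral_add j3 j2]
        congr 1
        refine integral_congr_ae (Eventually.of_forall fun x => ?_)
        simp only [inner_add_left, inner_smul_left, inner_gradient_left]
        simp
        ring

theorem hasWeakGradient_const (c : ℝ) :
    HasWeakGradient (fun _ : EuclideanSpace ℝ (Fin d) => c) (fun _ => 0) :=
  ⟨locallyIntegrable_const c, locallyIntegrable_const 0, fun φ hφ hφc v => by
    simp [integral_const_mul, integral_fderiv_apply_eq_zero hφ hφc v]⟩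

theorem hasWeakGradient_gradient {η : EuclideanSpace ℝ (Fin d) → ℝ} (hη : ContDiff ℝ ∞ η)
    (hηc : HasCompactSupport η) : HasWeakGradient η (gradient η) := by
  simpa using (hasWeakGradient_const (d := d) 1).smooth_mul hη hηc

end ProductRule

/-! ### The weak gradient on the zero level set -/

section LevelSet
open Filter Topology

variable {d : ℕ}

/-- A bump of height `1` at the origin whose width shrinks to zero: as `n → ∞` it decreases to
the indicator function of `{0}`. It is smooth, so that the chain rule needs no truncations. -/
noncomputable def spike (n : ℕ) (t : ℝ) : ℝ := 1 / (1 + (((n : ℝ) + 1) * t) ^ 2)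

theorem spike_pos (n : ℕ) (t : ℝ) : 0 < spike n t := by unfold spike; positivity

theorem spike_le_one (n : ℕ) (t : ℝ) : spike n t ≤ 1 := by
  unfold spike
  rw [div_le_one (by positivity)]
  nlinarith [sq_nonneg (((n : ℝ) + 1) * t)]

theorem spike_zero (n : ℕ) : spike n 0 = 1 := by simp [spike]

theorem contDiff_spike (n : ℕ) : ContDiff ℝ 1 (spike n) := by
  unfold spike
  refine contDiff_const.div (by fun_prop) fun t => ?_
  positivity

theorem spike_le_spike (n : ℕ) {a b : ℝ} (ha : 0 ≤ a) (hab : a ≤ b) : spike n b ≤ spike n a := by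
  unfold spike
  gcongr

theorem deriv_spike (n : ℕ) (t : ℝ) :
    deriv (spike n) t = -(2 * ((n : ℝ) + 1) ^ 2 * t) * spike n t ^ 2 := by
  have h : HasDerivAt (fun t : ℝ => 1 + (((n : ℝ) + 1) * t) ^ 2) (2 * ((n : ℝ) + 1) ^ 2 * t) t := by
    have := ((((hasDerivAt_id t).const_mul ((n : ℝ) + 1)).pow 2).const_add 1)
    refine this.congr_deriv ?_
    simp; ring
  have h2 := (h.inv (by positivity)).deriv
  have e : spike n = (fun t : ℝ => 1 + (((n : ℝ) + 1) * t) ^ 2)⁻¹ := by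
    ext t; simp [spike]
  rw [e, h2]
  simp only [Pi.inv_apply]
  rw [inv_pow, div_eq_mul_inv]

theorem abs_deriv_spike_le (n : ℕ) (t : ℝ) : |deriv (spike n) t| ≤ (n : ℝ) + 1 := by
  have hN : (0 : ℝ) < (n : ℝ) + 1 := by positivity
  have h1 : |2 * (((n : ℝ) + 1) * t)| * spike n t ≤ 1 := by
    unfold spike
    rw [mul_one_div, div_le_one (by positivity), abs_le']
    constructor <;> nlinarith [sq_nonneg (((n : ℝ) + 1) * t - 1), sq_nonneg (((n : ℝ) + 1) * t + 1)]
  have h2 : |deriv (spike n) t| =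
      ((n : ℝ) + 1) * (|2 * (((n : ℝ) + 1) * t)| * spike n t) * spike n t := by
    rw [deriv_spike, abs_mul, abs_neg, abs_of_nonneg (sq_nonneg (spike n t)),
      show 2 * ((n : ℝ) + 1) ^ 2 * t = ((n : ℝ) + 1) * (2 * (((n : ℝ) + 1) * t)) by ring,
      abs_mul ((n : ℝ) + 1), abs_of_pos hN]
    ring
  rw [h2]
  have := spike_le_one n t
  have := (spike_pos n t).le
  calc _ ≤ ((n : ℝ) + 1) * 1 * 1 := by gcongr
    _ = _ := by ring

theorem deriv_spike_nonpos (n : ℕ) {t : ℝ} (ht : 0 ≤ t) : deriv (spike n) t ≤ 0 := by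
  rw [deriv_spike, neg_mul]
  exact neg_nonpos.2 (by positivity)

theorem tendsto_spike (t : ℝ) :
    Tendsto (fun n => spike n t) atTop (𝓝 (if t = 0 then 1 else 0)) := by
  split_ifs with h
  · subst h
    simp [spike_zero]
  · unfold spike
    have h1 : Tendsto (fun n : ℕ => ((n : ℝ) + 1) ^ 2 * t ^ 2) atTop atTop := by
      refine Tendsto.atTop_mul_const (by positivity) ?_
      exact (tendsto_pow_atTop two_ne_zero).comp
        (tendsto_atTop_add_const_right _ _ tendsto_natCast_atTop_atTop)
    have h2 := (tendsto_atTop_add_const_left atTop 1 h1).inv_tendsto_atTop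
    refine h2.congr fun n => ?_
    simp [mul_pow]

/-- The weak gradient vanishes almost everywhere on the zero level set: apply the chain rule to
`arctan (n u) / n`, which tends to `0` uniformly while its derivative tends to the
indicator function of `{0}`. -/
theorem HasWeakGradient.ae_eq_zero_of_eq_zero {u : EuclideanSpace ℝ (Fin d) → ℝ}
    {g : EuclideanSpace ℝ (Fin d) → EuclideanSpace ℝ (Fin d)} (hg : HasWeakGradient u g)
    (hui : Integrable u) (hgi : Integrable g) : ∀ᵐ x, u x = 0 → g x = 0 := by
  set F : ℕ → ℝ → ℝ := fun n t => Real.arctan (((n : ℝ) + 1) * t) / ((n : ℝ) + 1) with hF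
  have hFd : ∀ n, deriv (F n) = spike n := by
    intro n
    ext t
    have hN : ((n : ℝ) + 1) ≠ 0 := by positivity
    have h1 := (((hasDerivAt_id t).const_mul ((n : ℝ) + 1)).arctan).div_const ((n : ℝ) + 1)
    simp only [id] at h1
    rw [hF, h1.deriv, spike]
    field_simp
  have hFc : ∀ n, ContDiff ℝ 1 (F n) := fun n => by
    refine ContDiff.div_const (Real.contDiff_arctan.comp (by fun_prop)) _
  have hFb : ∀ n t, |deriv (F n) t| ≤ 1 := fun n t => by
    rw [hFd, abs_of_pos (spike_pos n t)]
    exact spike_le_one n t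
  have hchain := fun n => hg.comp hui hgi (hFc n) (hFb n)
  simp only [hFd] at hchain
  set k : EuclideanSpace ℝ (Fin d) → EuclideanSpace ℝ (Fin d) :=
    fun x => (if u x = 0 then (1 : ℝ) else 0) • g x with hk
  have hsm : ∀ n, AEStronglyMeasurable (fun x => spike n (u x)) := fun n =>
    (contDiff_spike n).continuous.comp_aestronglyMeasurable hui.aestronglyMeasurable
  have hlim : ∀ x, Tendsto (fun n => spike n (u x) • g x) atTop (𝓝 (k x)) := fun x =>
    (tendsto_spike (u x)).smul_const _
  have hkm : AEStronglyMeasurable k :=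
    aestronglyMeasurable_of_tendsto_ae atTop (fun n => (hsm n).smul hgi.aestronglyMeasurable)
      (Eventually.of_forall hlim)
  have hki : Integrable k := by
    refine hgi.mono hkm (Eventually.of_forall fun x => ?_)
    simp only [hk]
    split_ifs <;> simp
  have hzero : ∀ φ : EuclideanSpace ℝ (Fin d) → ℝ, ContDiff ℝ ∞ φ → HasCompactSupport φ →
      ∫ x, φ x • k x = 0 := by
    intro φ hφ hφc
    obtain ⟨M, hM⟩ := hφc.exists_bound_of_continuous hφ.continuous
    have hφk : Integrable fun x => φ x • k x :=
      hki.bdd_smul M hφ.continuous.aestronglyMeasurable (Eventually.of_forall hM)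
    refine ext_inner_left ℝ fun v => ?_
    rw [inner_zero_right, ← integral_inner hφk v]
    have hdcont : Continuous fun x => fderiv ℝ φ x v :=
      (hφ.continuous_fderiv (by simp)).clm_apply continuous_const
    have hdi := hdcont.integrable_of_hasCompactSupport (μ := volume) (hφc.fderiv_apply (𝕜 := ℝ) v)
    have t1 : Tendsto (fun n => ∫ x, inner ℝ (spike n (u x) • g x) v * φ x) atTop
        (𝓝 (∫ x, inner ℝ (k x) v * φ x)) := by
      refine tendsto_integral_of_dominated_convergence (fun x => ‖g x‖ * ‖v‖ * M) ?_
        ((hgi.norm.mul_const _).mul_const _) ?_ ?_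
      · intro n
        exact (((hsm n).smul hgi.aestronglyMeasurable).inner aestronglyMeasurable_const).mul
          hφ.continuous.aestronglyMeasurable
      · refine fun n => Eventually.of_forall fun x => ?_
        rw [norm_mul]
        refine mul_le_mul ?_ (hM x) (norm_nonneg _) (by positivity)
        refine (norm_inner_le_norm _ _).trans ?_
        gcongr
        rw [norm_smul, Real.norm_of_nonneg (spike_pos n _).le]
        exact mul_le_of_le_one_left (norm_nonneg _) (spike_le_one n _)
      · exact Eventually.of_forall fun x => ((hlim x).inner tendsto_const_nhds).mul_const _
    have t2 : Tendsto (fun n => ∫ x, F n (u x) * fderiv ℝ φ x v) atTop (𝓝 0) := by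
      have h0 : Tendsto (fun n : ℕ => (Real.pi / 2) * (1 / ((n : ℝ) + 1)) *
          ∫ x, ‖fderiv ℝ φ x v‖) atTop (𝓝 0) := by
        have := (tendsto_one_div_add_atTop_nhds_zero_nat (𝕜 := ℝ)).const_mul (Real.pi / 2)
        simpa using this.mul_const (∫ x, ‖fderiv ℝ φ x v‖)
      refine squeeze_zero_norm (fun n => ?_) h0
      rw [← integral_const_mul]
      refine norm_integral_le_of_norm_le (hdi.norm.const_mul _) (Eventually.of_forall fun x => ?_)
      rw [norm_mul]
      refine mul_le_mul_of_nonneg_right ?_ (norm_nonneg _)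
      simp only [hF]
      rw [norm_div, Real.norm_of_nonneg (by positivity : (0 : ℝ) ≤ (n : ℝ) + 1), mul_one_div]
      gcongr
      exact abs_le.2 ⟨by linarith [Real.neg_pi_div_two_lt_arctan (((n : ℝ) + 1) * u x)],
        (Real.arctan_lt_pi_div_two _).le⟩
    have t3 := t2.congr fun n => (hchain n).integral_eq φ hφ hφc v
    have := tendsto_nhds_unique t1.neg t3
    rw [← neg_eq_zero, ← this]
    congr 1
    refine integral_congr_ae (Eventually.of_forall fun x => ?_)
    simp only [inner_smul_right, real_inner_comm]
    ring
  filter_upwards [ae_eq_zero_of_integral_contDiff_smul_eq_zero hki.locallyIntegrable hzero]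
    with x hx hux
  simpa [hk, hux] using hx

end LevelSet

/-! ### Functions vanishing outside a bounded set -/

section ZeroTrace
open Filter Topology

variable {d : ℕ}

theorem HasWeakGradient.ae_eq_zero_of_isOpen {u : EuclideanSpace ℝ (Fin d) → ℝ}
    {g : EuclideanSpace ℝ (Fin d) → EuclideanSpace ℝ (Fin d)} (hg : HasWeakGradient u g)
    {U : Set (EuclideanSpace ℝ (Fin d))} (hU : IsOpen U) (hu : ∀ᵐ x, x ∈ U → u x = 0) :
    ∀ᵐ x, x ∈ U → g x = 0 := by
  refine hU.ae_eq_zero_of_integral_contDiff_smul_eq_zero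
    (hg.locallyIntegrable_grad.locallyIntegrableOn U) fun φ hφ hφc hφU => ?_
  have hφg := hg.locallyIntegrable_grad.integrable_smul_left_of_hasCompactSupport
    hφ.continuous hφc
  refine ext_inner_left ℝ fun v => ?_
  rw [inner_zero_right, ← integral_inner hφg v]
  have h0 : ∫ x, u x * fderiv ℝ φ x v = 0 := by
    refine integral_eq_zero_of_ae ?_
    filter_upwards [hu] with x hx
    by_cases hxU : x ∈ U
    · simp [hx hxU]
    · have : x ∉ tsupport (fderiv ℝ φ) := fun h => hxU (hφU (tsupport_fderiv_subset ℝ h))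
      simp [image_eq_zero_of_notMem_tsupport this]
  rw [hg.integral_eq φ hφ hφc v, neg_eq_zero] at h0
  rw [← h0]
  refine integral_congr_ae (Eventually.of_forall fun x => ?_)
  simp only [inner_smul_right, real_inner_comm]
  ring

theorem MeasureTheory.MemLp.integrable_of_ae_eq_zero_off_isCompact {F : Type*}
    [NormedAddCommGroup F] {p : ENNReal} (hp : 1 ≤ p) {f : EuclideanSpace ℝ (Fin d) → F} (hf : MemLp f p)
    {K : Set (EuclideanSpace ℝ (Fin d))} (hK : IsCompact K) (h0 : ∀ᵐ x, x ∉ K → f x = 0) :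
    Integrable f := by
  have : IsFiniteMeasure (volume.restrict K) := ⟨by simpa using hK.measure_lt_top⟩
  have h1 : IntegrableOn f K := (hf.restrict K).integrable hp
  exact h1.integrable_of_ae_notMem_eq_zero h0

variable {p : ℝ} {Ω : Set (EuclideanSpace ℝ (Fin d))} {u : EuclideanSpace ℝ (Fin d) → ℝ}

theorem MemW1p0.hasWeakGradient (hu : MemW1p0 p Ω u) : HasWeakGradient u (weakGrad u) :=
  hu.exists_weakGradient.choose_spec.hasWeakGradient_weakGrad

theorem MemW1p0.integrable (hp : 1 < p) (hΩ : Bornology.IsBounded Ω) (hu : MemW1p0 p Ω u) :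
    Integrable u := by
  refine hu.memLp.integrable_of_ae_eq_zero_off_isCompact (by simpa using hp.le)
    hΩ.isCompact_closure ?_
  filter_upwards [hu.eq_zero] with x hx h
  exact hx fun h' => h (subset_closure h')

/-- Membership in `L^p` gives integrability because `∇u` vanishes almost everywhere outside the
closure of `Ω`; the boundary of `Ω` may have positive measure, so `Ω` itself would not do at once. -/
theorem MemW1p0.integrable_weakGrad (hp : 1 < p) (hΩ : Bornology.IsBounded Ω)
    (hu : MemW1p0 p Ω u) : Integrable (weakGrad u) := by
  refine hu.memLp_grad.integrable_of_ae_eq_zero_off_isCompact (by simpa using hp.le)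
    hΩ.isCompact_closure ?_
  refine hu.hasWeakGradient.ae_eq_zero_of_isOpen isClosed_closure.isOpen_compl ?_
  filter_upwards [hu.eq_zero] with x hx h
  exact hx fun h' => h (subset_closure h')

theorem MemW1p0.of_hasWeakGradient {g : EuclideanSpace ℝ (Fin d) → EuclideanSpace ℝ (Fin d)}
    (hu : MemLp u (ENNReal.ofReal p)) (hg : HasWeakGradient u g) (hgp : MemLp g (ENNReal.ofReal p))
    (h0 : ∀ᵐ x, x ∉ Ω → u x = 0) : MemW1p0 p Ω u :=
  ⟨hu, ⟨g, hg⟩, hgp.ae_eq (hg.ae_eq hg.hasWeakGradient_weakGrad), h0⟩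

theorem memW1p0_of_contDiff {η : EuclideanSpace ℝ (Fin d) → ℝ} (hη : ContDiff ℝ ∞ η)
    (hηc : HasCompactSupport η) (h0 : ∀ x, x ∉ Ω → η x = 0) : MemW1p0 p Ω η :=
  .of_hasWeakGradient (hη.continuous.memLp_of_hasCompactSupport hηc)
    (hasWeakGradient_gradient hη hηc)
    ((continuous_gradient_of_contDiff hη).memLp_of_hasCompactSupport
      (hasCompactSupport_gradient hηc)) (Eventually.of_forall h0)

end ZeroTrace

/-! ### Finiteness of the Gagliardo seminorm -/

section Gagliardo
open Filter Topology

/-- Jensen's inequality for the convex function `|t| ^ p`. -/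
theorem abs_integral_rpow_le {α : Type*} [MeasurableSpace α] {ν : Measure α}
    [IsProbabilityMeasure ν] {f : α → ℝ} {p : ℝ} (hp : 1 ≤ p) (hf : Integrable f ν)
    (hfp : Integrable (fun t => |f t| ^ p) ν) : |∫ t, f t ∂ν| ^ p ≤ ∫ t, |f t| ^ p ∂ν := by
  refine (Real.rpow_le_rpow (abs_nonneg _) (norm_integral_le_integral_norm f)
    (zero_le_one.trans hp)).trans ?_
  exact (convexOn_rpow hp).map_integral_le
    (continuousOn_id.rpow_const fun _ _ => Or.inr (zero_le_one.trans hp)) isClosed_Ici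
    (Eventually.of_forall fun t => norm_nonneg (f t)) hf.norm hfp

theorem abs_sub_rpow_le {p : ℝ} (hp : 0 ≤ p) (a b : ℝ) :
    |a - b| ^ p ≤ 2 ^ p * (|a| ^ p + |b| ^ p) := by
  have h1 : |a - b| ≤ 2 * max |a| |b| := by
    have := abs_sub a b
    have := le_max_left |a| |b|
    have := le_max_right |a| |b|
    linarith
  refine (Real.rpow_le_rpow (abs_nonneg _) h1 hp).trans ?_
  rw [Real.mul_rpow zero_le_two (le_max_of_le_left (abs_nonneg a))]
  gcongr
  rcases max_choice |a| |b| with h | h <;> rw [h]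
  · exact le_add_of_nonneg_right (by positivity)
  · exact le_add_of_nonneg_left (by positivity)

variable {d : ℕ}

/-- `‖u(· + h) - u‖_p ≤ ‖h‖ ‖∇u‖_p`. -/
theorem HasWeakGradient.integral_abs_translate_sub_rpow_le {u : EuclideanSpace ℝ (Fin d) → ℝ}
    {g : EuclideanSpace ℝ (Fin d) → EuclideanSpace ℝ (Fin d)} (hg : HasWeakGradient u g)
    (hui : Integrable u) (hgi : Integrable g) {p : ℝ} (hp : 1 ≤ p)
    (hgp : Integrable fun x => ‖g x‖ ^ p) (h : EuclideanSpace ℝ (Fin d)) :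
    ∫ x, |u (x + h) - u x| ^ p ≤ ‖h‖ ^ p * ∫ x, ‖g x‖ ^ p := by
  have hp0 : 0 ≤ p := zero_le_one.trans hp
  set ν : Measure ℝ := volume.restrict (Set.Ioc (0 : ℝ) 1) with hν
  have : IsProbabilityMeasure ν := ⟨by simp [hν]⟩
  have hprod : Integrable (fun z : EuclideanSpace ℝ (Fin d) × ℝ =>
      ‖h‖ ^ p * ‖g (z.1 + z.2 • h)‖ ^ p) (volume.prod ν) :=
    (integrable_prod_translate ν (f := fun x => ‖g x‖ ^ p) hgp h).const_mul _
  have hGprod : Integrable (fun z : EuclideanSpace ℝ (Fin d) × ℝ =>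
      inner ℝ (g (z.1 + z.2 • h)) h) (volume.prod ν) :=
    integrable_prod_translate ν (f := fun x => (inner ℝ (g x) h : ℝ)) (hgi.inner_const h) h
  calc ∫ x, |u (x + h) - u x| ^ p ≤ ∫ x, (∫ t, ‖h‖ ^ p * ‖g (x + t • h)‖ ^ p ∂ν) := by
        refine integral_mono_of_nonneg (Eventually.of_forall fun x => by positivity)
          hprod.integral_prod_left ?_
        filter_upwards [hg.translate_sub_ae_eq hui hgi h, hprod.prod_right_ae,
          hGprod.prod_right_ae] with x hx hx1 hx2
        have hb : ∀ t : ℝ, |inner ℝ (g (x + t • h)) h| ^ p ≤ ‖h‖ ^ p * ‖g (x + t • h)‖ ^ p := by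
          intro t
          rw [← Real.mul_rpow (norm_nonneg _) (norm_nonneg _), mul_comm ‖h‖]
          exact Real.rpow_le_rpow (abs_nonneg _) (abs_real_inner_le_norm _ _) hp0
        have hm : Integrable (fun t : ℝ => |inner ℝ (g (x + t • h)) h| ^ p) ν := by
          refine hx1.mono ?_ (Eventually.of_forall fun t => ?_)
          · exact (hx2.abs.aestronglyMeasurable.aemeasurable.pow_const p).aestronglyMeasurable
          · rw [Real.norm_of_nonneg (by positivity), Real.norm_of_nonneg (by positivity)]
            exact hb t
        rw [hx]
        exact (abs_integral_rpow_le hp hx2 hm).trans (integral_mono hm hx1 hb)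
    _ = ∫ t, (∫ x, ‖h‖ ^ p * ‖g (x + t • h)‖ ^ p) ∂ν := integral_integral_swap hprod
    _ = ‖h‖ ^ p * ∫ x, ‖g x‖ ^ p := by
        have e : ∀ t : ℝ, ∫ x, ‖g (x + t • h)‖ ^ p = ∫ x, ‖g x‖ ^ p := fun t =>
          integral_add_right_eq_self (fun x => ‖g x‖ ^ p) (t • h)
        simp [integral_const_mul, e]

/-- The kernel that dominates the translation estimates. Integrability at the origin uses `s < 1`,
integrability at infinity uses `0 < s`. -/
theorem integrable_min_norm_rpow_div (hd : 1 ≤ d) {p s : ℝ} (hp : 0 < p) (hs0 : 0 < s)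
    (hs1 : s < 1) : Integrable fun h : EuclideanSpace ℝ (Fin d) =>
      min (‖h‖ ^ p) 1 / ‖h‖ ^ ((d : ℝ) + p * s) := by
  have : Nonempty (Fin d) := ⟨⟨0, hd⟩⟩
  have hps : 0 < p * s := mul_pos hp hs0
  rw [integrable_fun_norm_addHaar volume
    (f := fun y : ℝ => min (y ^ p) 1 / y ^ ((d : ℝ) + p * s))]
  have hpow : ∀ y : ℝ, 0 < y → y ^ (d - 1) = y ^ ((d : ℝ) - 1) := by
    intro y hy
    rw [← Real.rpow_natCast, Nat.cast_sub hd, Nat.cast_one]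
  rw [finrank_euclideanSpace_fin, ← Set.Ioc_union_Ioi_eq_Ioi zero_le_one, integrableOn_union]
  constructor
  · have h1 : IntegrableOn (fun y : ℝ => y ^ (p - p * s - 1)) (Set.Ioc 0 1) := by
      rw [← intervalIntegrable_iff_integrableOn_Ioc_of_le zero_le_one]
      exact intervalIntegral.intervalIntegrable_rpow' (by nlinarith)
    refine h1.congr_fun (fun y hy => ?_) measurableSet_Ioc
    simp only [smul_eq_mul]
    rw [hpow y hy.1, min_eq_left (Real.rpow_le_one hy.1.le hy.2 hp.le), ← mul_div_assoc,
      ← Real.rpow_add hy.1, ← Real.rpow_sub hy.1]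
    congr 1
    ring
  · have h1 : IntegrableOn (fun y : ℝ => y ^ (-1 - p * s)) (Set.Ioi 1) :=
      integrableOn_Ioi_rpow_of_lt (by linarith) zero_lt_one
    refine h1.congr_fun (fun y hy => ?_) measurableSet_Ioi
    have hy0 : (0 : ℝ) < y := zero_lt_one.trans hy
    simp only [smul_eq_mul]
    rw [hpow y hy0, min_eq_right (Real.one_le_rpow (le_of_lt hy) hp.le), mul_one_div,
      ← Real.rpow_sub hy0]
    congr 1
    ring

theorem aemeasurable_sub_prod {u : EuclideanSpace ℝ (Fin d) → ℝ} (hu : AEStronglyMeasurable u) :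
    AEMeasurable (fun z : EuclideanSpace ℝ (Fin d) × EuclideanSpace ℝ (Fin d) => u z.1 - u z.2)
      (volume.prod volume) :=
  (hu.comp_fst.sub hu.comp_snd).aemeasurable

/-- Finiteness of the Gagliardo seminorm: `W_0^{1,p}(Ω)` embeds into `W^{s,p}(ℝ^d)`. -/
theorem MemW1p0.integrable_gagliardo (hd : 1 ≤ d) {p s : ℝ} (hp : 1 < p) (hs0 : 0 < s)
    (hs1 : s < 1) {Ω : Set (EuclideanSpace ℝ (Fin d))} (hΩ : Bornology.IsBounded Ω)
    {u : EuclideanSpace ℝ (Fin d) → ℝ} (hu : MemW1p0 p Ω u) :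
    Integrable (fun z : EuclideanSpace ℝ (Fin d) × EuclideanSpace ℝ (Fin d) =>
      |u z.1 - u z.2| ^ p / ‖z.1 - z.2‖ ^ ((d : ℝ) + p * s)) (volume.prod volume) := by
  have hp0 : 0 < p := zero_lt_one.trans hp
  have hpe : ENNReal.ofReal p ≠ 0 := by simpa using hp0
  have hum : AEStronglyMeasurable u := hu.memLp.aestronglyMeasurable
  have hup : Integrable fun x => |u x| ^ p := by
    simpa [ENNReal.toReal_ofReal hp0.le] using
      hu.memLp.integrable_norm_rpow hpe ENNReal.ofReal_ne_top
  have hgp : Integrable fun x => ‖weakGrad u x‖ ^ p := by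
    simpa [ENNReal.toReal_ofReal hp0.le] using
      hu.memLp_grad.integrable_norm_rpow hpe ENNReal.ofReal_ne_top
  have hmeas : AEStronglyMeasurable
      (fun z : EuclideanSpace ℝ (Fin d) × EuclideanSpace ℝ (Fin d) =>
        |u z.1 - u z.2| ^ p / ‖z.1 - z.2‖ ^ ((d : ℝ) + p * s)) (volume.prod volume) :=
    (((continuous_abs.measurable.comp_aemeasurable (aemeasurable_sub_prod hum)).pow_const p).div
      (by fun_prop)).aestronglyMeasurable
  have hT := measurePreserving_prod_add (volume : Measure (EuclideanSpace ℝ (Fin d)))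
    (volume : Measure (EuclideanSpace ℝ (Fin d)))
  -- In the coordinates `(x, h)` with `y = x + h` a translation estimate bounds the integral over `x`.
  rw [← hT.integrable_comp hmeas, integrable_prod_iff' (hmeas.comp_measurePreserving hT)]
  have hsum : ∀ h, Integrable fun x => 2 ^ p * (|u (x + h)| ^ p + |u x| ^ p) := fun h =>
    ((hup.comp_add_right h).add hup).const_mul (2 ^ p)
  have hdiff : ∀ h, Integrable fun x => |u (x + h) - u x| ^ p := by
    intro h
    refine (hsum h).mono ?_
      (Eventually.of_forall fun x => ?_)
    · exact (continuous_abs.measurable.comp_aemeasurable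
        (((hu.integrable hp hΩ).comp_add_right h).aestronglyMeasurable.sub
          hum).aemeasurable).pow_const p |>.aestronglyMeasurable
    · rw [Real.norm_of_nonneg (by positivity), Real.norm_of_nonneg (by positivity)]
      exact abs_sub_rpow_le hp0.le _ _
  have hsimp : ∀ x h, |u x - u (x + h)| ^ p / ‖x - (x + h)‖ ^ ((d : ℝ) + p * s) =
      |u (x + h) - u x| ^ p / ‖h‖ ^ ((d : ℝ) + p * s) := by
    intro x h
    rw [abs_sub_comm, sub_add_cancel_left, norm_neg]
  constructor
  · refine Eventually.of_forall fun h => ?_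
    simp only [Function.comp_def, hsimp]
    exact (hdiff h).div_const _
  · set A : ℝ := max (∫ x, ‖weakGrad u x‖ ^ p) (2 ^ p * (2 * ∫ x, |u x| ^ p)) with hA
    have hA0 : 0 ≤ A := le_max_of_le_left (integral_nonneg fun x => by positivity)
    refine ((integrable_min_norm_rpow_div hd hp0 hs0 hs1).const_mul A).mono
      (hmeas.comp_measurePreserving hT).norm.prod_swap.integral_prod_right'
      (Eventually.of_forall fun h => ?_)
    simp only [Function.comp_def, hsimp]
    have hn : ∀ x, ‖|u (x + h) - u x| ^ p / ‖h‖ ^ ((d : ℝ) + p * s)‖ =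
        |u (x + h) - u x| ^ p / ‖h‖ ^ ((d : ℝ) + p * s) :=
      fun x => Real.norm_of_nonneg (by positivity)
    simp only [hn, integral_div]
    rw [Real.norm_of_nonneg (div_nonneg (integral_nonneg fun x => by positivity) (by positivity)),
      Real.norm_of_nonneg (by positivity), ← mul_div_assoc]
    gcongr
    -- For small `h` the gradient bounds the increment, for large `h` the function itself does.
    rw [mul_min_of_nonneg _ _ hA0, mul_one]
    refine le_min ?_ ?_
    · refine (hu.hasWeakGradient.integral_abs_translate_sub_rpow_le (hu.integrable hp hΩ)
        (hu.integrable_weakGrad hp hΩ) hp.le hgp h).trans ?_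
      rw [mul_comm]
      gcongr
      exact le_max_left _ _
    · refine le_trans ?_ (le_max_right _ _)
      refine (integral_mono (hdiff h) (hsum h) fun x => abs_sub_rpow_le hp0.le _ _).trans
        (le_of_eq ?_)
      rw [integral_const_mul, integral_add (hup.comp_add_right h) hup,
        integral_add_right_eq_self (fun x => |u x| ^ p) h]
      ring

end Gagliardo

/-! ### Integrability of the mixed form -/

section Form
open Filter Topology

/-- A form of Young's inequality that makes `|∇u|^{p-2} ∇u · ∇φ` integrable, and likewise its
nonlocal analogue. At `a = 0` the factor `a` makes the left-hand side vanish, whatever the value of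
`0 ^ (p - 2)`. -/
theorem rpow_sub_two_mul_le {p : ℝ} (hp : 1 < p) {a b : ℝ} (ha : 0 ≤ a) (hb : 0 ≤ b) :
    a ^ (p - 2) * (a * b) ≤ a ^ p + b ^ p := by
  rcases ha.eq_or_lt with rfl | ha'
  · simp only [zero_mul, mul_zero]
    positivity
  have e : a ^ (p - 2) * (a * b) = a ^ (p - 1) * b := by
    rw [← mul_assoc]
    congr 1
    conv_lhs => rw [← Real.rpow_one a, ← Real.rpow_mul ha, one_mul, ← Real.rpow_add ha']
    congr 1
    ring
  have hm : 0 < max a b := lt_max_of_lt_left ha'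
  rw [e]
  calc a ^ (p - 1) * b ≤ max a b ^ (p - 1) * max a b := by
        have hp1 : 0 ≤ p - 1 := by linarith
        gcongr
        · exact le_max_left _ _
        · exact le_max_right _ _
    _ = max a b ^ p := by
        conv_lhs => rw [← Real.rpow_add_one hm.ne']
        congr 1
        ring
    _ ≤ a ^ p + b ^ p := by
        rcases max_choice a b with h | h <;> rw [h]
        · exact le_add_of_nonneg_right (by positivity)
        · exact le_add_of_nonneg_left (by positivity)

variable {d : ℕ} {p s : ℝ} {Ω : Set (EuclideanSpace ℝ (Fin d))}
  {u φ : EuclideanSpace ℝ (Fin d) → ℝ}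

theorem MemW1p0.integrable_norm_weakGrad_rpow (hp : 1 < p) (hu : MemW1p0 p Ω u) :
    Integrable fun x => ‖weakGrad u x‖ ^ p := by
  have hp0 : 0 < p := zero_lt_one.trans hp
  simpa [ENNReal.toReal_ofReal hp0.le] using
    hu.memLp_grad.integrable_norm_rpow (by simpa using hp0) ENNReal.ofReal_ne_top

theorem MemW1p0.integrable_local (hp : 1 < p) (hu : MemW1p0 p Ω u) (hφ : MemW1p0 p Ω φ) :
    Integrable fun x => ‖weakGrad u x‖ ^ (p - 2) * inner ℝ (weakGrad u x) (weakGrad φ x) := by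
  have hum := hu.memLp_grad.aestronglyMeasurable
  refine ((hu.integrable_norm_weakGrad_rpow hp).add
    (hφ.integrable_norm_weakGrad_rpow hp)).mono' ?_ (Eventually.of_forall fun x => ?_)
  · exact ((hum.norm.aemeasurable.pow_const (p - 2)).aestronglyMeasurable).mul
      (hum.inner hφ.memLp_grad.aestronglyMeasurable)
  · rw [norm_mul, Real.norm_of_nonneg (by positivity)]
    refine le_trans ?_ (rpow_sub_two_mul_le hp (norm_nonneg _) (norm_nonneg _))
    gcongr
    exact norm_inner_le_norm _ _

theorem MemW1p0.integrable_nonlocal (hd : 1 ≤ d) (hp : 1 < p) (hs0 : 0 < s) (hs1 : s < 1)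
    (hΩ : Bornology.IsBounded Ω) (hu : MemW1p0 p Ω u) (hφ : MemW1p0 p Ω φ) :
    Integrable (fun z : EuclideanSpace ℝ (Fin d) × EuclideanSpace ℝ (Fin d) =>
      |u z.1 - u z.2| ^ (p - 2) * (u z.1 - u z.2) / ‖z.1 - z.2‖ ^ ((d : ℝ) + p * s) *
        (φ z.1 - φ z.2)) (volume.prod volume) := by
  have hum := aemeasurable_sub_prod hu.memLp.aestronglyMeasurable
  have hφm := aemeasurable_sub_prod hφ.memLp.aestronglyMeasurable
  refine ((hu.integrable_gagliardo hd hp hs0 hs1 hΩ).add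
    (hφ.integrable_gagliardo hd hp hs0 hs1 hΩ)).mono' ?_ (Eventually.of_forall fun z => ?_)
  · exact (((((continuous_abs.measurable.comp_aemeasurable hum).pow_const (p - 2)).mul hum).div
      (by fun_prop)).mul hφm).aestronglyMeasurable
  · simp only [Pi.add_apply]
    rw [← add_div, norm_mul, norm_div, norm_mul, Real.norm_of_nonneg (by positivity),
      Real.norm_of_nonneg (r := ‖z.1 - z.2‖ ^ _) (by positivity), div_mul_eq_mul_div, mul_assoc]
    gcongr
    exact rpow_sub_two_mul_le hp (abs_nonneg _) (abs_nonneg _)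

theorem mixedForm_eq (hd : 1 ≤ d) (hp : 1 < p) (hs0 : 0 < s) (hs1 : s < 1)
    (hΩ : Bornology.IsBounded Ω) (hu : MemW1p0 p Ω u) (hφ : MemW1p0 p Ω φ) :
    mixedForm p s Ω u φ =
      (∫ x in Ω, ‖weakGrad u x‖ ^ (p - 2) * inner ℝ (weakGrad u x) (weakGrad φ x)) +
      ∫ z, |u z.1 - u z.2| ^ (p - 2) * (u z.1 - u z.2) / ‖z.1 - z.2‖ ^ ((d : ℝ) + p * s) *
        (φ z.1 - φ z.2) ∂(volume.prod volume) := by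
  rw [mixedForm, integral_prod _ (hu.integrable_nonlocal hd hp hs0 hs1 hΩ hφ)]

end Form

/-! ### The test functions -/

section TestFunction
open Filter Topology

variable {d : ℕ} {p s : ℝ} {Ω : Set (EuclideanSpace ℝ (Fin d))}
  {u η : EuclideanSpace ℝ (Fin d) → ℝ}

theorem MemW1p0.hasWeakGradient_mul_spike (hp : 1 < p) (hΩ : Bornology.IsBounded Ω)
    (hu : MemW1p0 p Ω u) (hη : ContDiff ℝ ∞ η) (hηc : HasCompactSupport η) (n : ℕ) :
    HasWeakGradient (fun x => η x * spike n (u x))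
      (fun x => η x • deriv (spike n) (u x) • weakGrad u x + spike n (u x) • gradient η x) :=
  (hu.hasWeakGradient.comp (hu.integrable hp hΩ) (hu.integrable_weakGrad hp hΩ)
    (contDiff_spike n) (abs_deriv_spike_le n)).smooth_mul hη hηc

theorem MemW1p0.mul_spike (hp : 1 < p) (hΩ : Bornology.IsBounded Ω)
    (hu : MemW1p0 p Ω u) (hη : ContDiff ℝ ∞ η) (hηc : HasCompactSupport η)
    (hη0 : ∀ x, x ∉ Ω → η x = 0) (n : ℕ) :
    MemW1p0 p Ω (fun x => η x * spike n (u x)) := by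
  obtain ⟨M, hM⟩ := hηc.exists_bound_of_continuous hη.continuous
  have hum := hu.memLp.aestronglyMeasurable
  have hsm : AEStronglyMeasurable (fun x => spike n (u x)) :=
    (contDiff_spike n).continuous.comp_aestronglyMeasurable hum
  have hdm : AEStronglyMeasurable (fun x => deriv (spike n) (u x)) :=
    ((contDiff_spike n).continuous_deriv le_rfl).comp_aestronglyMeasurable hum
  have hs : ∀ t, ‖spike n t‖ ≤ 1 := fun t => by
    rw [Real.norm_of_nonneg (spike_pos n t).le]
    exact spike_le_one n t
  refine .of_hasWeakGradient ?_ (hu.hasWeakGradient_mul_spike hp hΩ hη hηc n) ?_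
    (Eventually.of_forall fun x hx => by simp [hη0 x hx])
  · refine (hη.continuous.memLp_of_hasCompactSupport (p := ENNReal.ofReal p) (μ := volume)
      hηc).of_le (hη.continuous.aestronglyMeasurable.mul hsm) (Eventually.of_forall fun x => ?_)
    rw [norm_mul]
    exact mul_le_of_le_one_right (norm_nonneg _) (hs _)
  · have hgc := continuous_gradient_of_contDiff hη
    refine MemLp.add ?_ ?_
    · refine hu.memLp_grad.of_le_mul (c := M * ((n : ℝ) + 1))
        (hη.continuous.aestronglyMeasurable.smul (hdm.smul hu.memLp_grad.aestronglyMeasurable))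
        (Eventually.of_forall fun x => ?_)
      rw [norm_smul, norm_smul, ← mul_assoc]
      refine mul_le_mul_of_nonneg_right ?_ (norm_nonneg _)
      exact mul_le_mul (hM x) (abs_deriv_spike_le n _) (norm_nonneg _)
        ((norm_nonneg _).trans (hM x))
    · refine (hgc.memLp_of_hasCompactSupport (p := ENNReal.ofReal p) (μ := volume)
        (hasCompactSupport_gradient hηc)).of_le (hsm.smul hgc.aestronglyMeasurable)
        (Eventually.of_forall fun x => ?_)
      rw [norm_smul]
      exact mul_le_of_le_one_left (norm_nonneg _) (hs _)

/-- The part of `∇(η hₙ(u))` along `∇u` contributes nonpositively to the local term. -/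
theorem setIntegral_local_mul_spike_le (hp : 1 < p) (hΩ : Bornology.IsBounded Ω)
    (hu : MemW1p0 p Ω u) (hu0 : 0 ≤ᵐ[volume] u) (hη : ContDiff ℝ ∞ η) (hηc : HasCompactSupport η)
    (hη0 : ∀ x, x ∉ Ω → η x = 0) (hηn : ∀ x, 0 ≤ η x) (n : ℕ) :
    ∫ x in Ω, ‖weakGrad u x‖ ^ (p - 2) *
        inner ℝ (weakGrad u x) (weakGrad (fun x => η x * spike n (u x)) x) ≤
      ∫ x in Ω, ‖weakGrad u x‖ ^ (p - 2) * inner ℝ (weakGrad u x) (weakGrad η x) *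
        spike n (u x) := by
  have hφ := hu.mul_spike hp hΩ hη hηc hη0 n
  have hsm : AEStronglyMeasurable (fun x => spike n (u x)) :=
    (contDiff_spike n).continuous.comp_aestronglyMeasurable hu.memLp.aestronglyMeasurable
  refine integral_mono_ae (hu.integrable_local hp hφ).integrableOn
    (((hu.integrable_local hp (memW1p0_of_contDiff hη hηc hη0)).mul_bdd (c := 1) hsm
      (Eventually.of_forall fun x => ?_)).integrableOn) (ae_restrict_of_ae ?_)
  · rw [Real.norm_of_nonneg (spike_pos n _).le]
    exact spike_le_one n _
  have e1 := hφ.hasWeakGradient.ae_eq (hu.hasWeakGradient_mul_spike hp hΩ hη hηc n)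
  have e2 := (memW1p0_of_contDiff (p := p) hη hηc hη0).hasWeakGradient.ae_eq
    (hasWeakGradient_gradient hη hηc)
  filter_upwards [e1, e2, hu0] with x h1 h2 h3
  rw [h1, h2, inner_add_right, inner_smul_right, inner_smul_right, inner_smul_right,
    real_inner_self_eq_norm_sq, mul_add, mul_assoc, mul_comm (spike n (u x))]
  refine add_le_of_nonpos_left (mul_nonpos_of_nonneg_of_nonpos (by positivity) ?_)
  exact mul_nonpos_of_nonneg_of_nonpos (hηn x)
    (mul_nonpos_of_nonpos_of_nonneg (deriv_spike_nonpos n h3) (sq_nonneg _))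

/-- In the limit only the set `{u = 0}` contributes, and there `∇u = 0` almost everywhere. -/
theorem tendsto_setIntegral_local_spike (hp : 1 < p) (hΩ : Bornology.IsBounded Ω)
    (hu : MemW1p0 p Ω u) (hη : MemW1p0 p Ω η) :
    Tendsto (fun n => ∫ x in Ω, ‖weakGrad u x‖ ^ (p - 2) *
      inner ℝ (weakGrad u x) (weakGrad η x) * spike n (u x)) atTop (𝓝 0) := by
  have hi := (hu.integrable_local hp hη).integrableOn (s := Ω)
  rw [← integral_zero (EuclideanSpace ℝ (Fin d)) ℝ (μ := volume.restrict Ω)]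
  refine tendsto_integral_of_dominated_convergence _ (fun n => ?_) hi.norm (fun n => ?_) ?_
  · exact hi.aestronglyMeasurable.mul ((contDiff_spike n).continuous.comp_aestronglyMeasurable
      hu.memLp.aestronglyMeasurable).restrict
  · refine Eventually.of_forall fun x => ?_
    rw [norm_mul, Real.norm_of_nonneg (spike_pos n _).le]
    exact mul_le_of_le_one_right (norm_nonneg _) (spike_le_one n _)
  · refine ae_restrict_of_ae ?_
    filter_upwards [hu.hasWeakGradient.ae_eq_zero_of_eq_zero (hu.integrable hp hΩ)
      (hu.integrable_weakGrad hp hΩ)] with x hx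
    have := (tendsto_spike (u x)).const_mul
      (‖weakGrad u x‖ ^ (p - 2) * inner ℝ (weakGrad u x) (weakGrad η x))
    by_cases h : u x = 0
    · simp [hx h]
    · simpa [h] using this

/-- Since `spike n` decreases on `[0, ∞)`, the part of the difference `φ(x) - φ(y)` that comes
from `spike n` has the sign opposite to `a - b`. -/
theorem nonlocal_mul_spike_le {q k a b e f : ℝ} (hk : 0 ≤ k) (ha : 0 ≤ a) (hb : 0 ≤ b)
    (he : 0 ≤ e) (n : ℕ) :
    |a - b| ^ q * (a - b) / k * (e * spike n a - f * spike n b) ≤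
      |(|a - b| ^ q * (a - b) / k * (e - f))| := by
  have h1 : (a - b) * (spike n a - spike n b) ≤ 0 := by
    rcases le_total a b with h | h
    · exact mul_nonpos_of_nonpos_of_nonneg (by linarith) (by linarith [spike_le_spike n ha h])
    · exact mul_nonpos_of_nonneg_of_nonpos (by linarith) (by linarith [spike_le_spike n hb h])
  have h2 : |a - b| ^ q / k * e * ((a - b) * (spike n a - spike n b)) ≤ 0 :=
    mul_nonpos_of_nonneg_of_nonpos (by positivity) h1
  have h3 : |a - b| ^ q * (a - b) / k * (e - f) * spike n b ≤
      |(|a - b| ^ q * (a - b) / k * (e - f))| :=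
    (mul_le_mul_of_nonneg_right (le_abs_self _) (spike_pos n b).le).trans
      (mul_le_of_le_one_right (abs_nonneg _) (spike_le_one n b))
  calc _ = |a - b| ^ q / k * e * ((a - b) * (spike n a - spike n b)) +
        |a - b| ^ q * (a - b) / k * (e - f) * spike n b := by ring
    _ ≤ _ := by linarith

end TestFunction

/-! ### Passage to the limit -/

section Limit
open Filter Topology

/-- A consequence of Fatou's lemma: if integrals of functions with a common integrable upper bound
are asymptotically nonnegative and the pointwise limit is nonpositive, then the limit vanishes almost
everywhere. -/
theorem ae_eq_zero_of_tendsto_of_le {α : Type*} [MeasurableSpace α] {μ : Measure α}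
    {G : ℕ → α → ℝ} {G₀ D : α → ℝ} (hD : Integrable D μ) (hD0 : ∀ x, 0 ≤ D x)
    (hG : ∀ n, Integrable (G n) μ) (hGD : ∀ n, ∀ᵐ x ∂μ, G n x ≤ D x)
    (hlim : ∀ᵐ x ∂μ, Tendsto (fun n => G n x) atTop (𝓝 (G₀ x))) (hG₀ : ∀ᵐ x ∂μ, G₀ x ≤ 0)
    {a : ℕ → ℝ} (ha : Tendsto a atTop (𝓝 0)) (hint : ∀ n, 0 ≤ a n + ∫ x, G n x ∂μ) :
    ∀ᵐ x ∂μ, G₀ x = 0 := by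
  have hG₀m : AEMeasurable G₀ μ :=
    aemeasurable_of_tendsto_metrizable_ae atTop (fun n => (hG n).aestronglyMeasurable.aemeasurable)
      hlim
  have hDm : AEMeasurable D μ := hD.aestronglyMeasurable.aemeasurable
  have key : ∫⁻ x, ENNReal.ofReal (D x) + ENNReal.ofReal (-G₀ x) ∂μ ≤
      ENNReal.ofReal (∫ x, D x ∂μ) := by
    calc ∫⁻ x, ENNReal.ofReal (D x) + ENNReal.ofReal (-G₀ x) ∂μ
        = ∫⁻ x, liminf (fun n => ENNReal.ofReal (D x - G n x)) atTop ∂μ := by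
          refine lintegral_congr_ae ?_
          filter_upwards [hlim, hG₀] with x hx h0
          have := ENNReal.tendsto_ofReal (hx.const_sub (D x))
          rw [this.liminf_eq, sub_eq_add_neg, ENNReal.ofReal_add (hD0 x) (by linarith)]
      _ ≤ liminf (fun n => ∫⁻ x, ENNReal.ofReal (D x - G n x) ∂μ) atTop :=
          lintegral_liminf_le' fun n =>
            (hD.sub (hG n)).aestronglyMeasurable.aemeasurable.ennreal_ofReal
      _ ≤ liminf (fun n => ENNReal.ofReal ((∫ x, D x ∂μ) + a n)) atTop := by
          refine liminf_le_liminf (Eventually.of_forall fun n => ?_)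
          rw [← ofReal_integral_eq_lintegral_ofReal (f := fun x => D x - G n x) (hD.sub (hG n))
            ((hGD n).mono fun x hx => sub_nonneg.2 hx)]
          refine ENNReal.ofReal_le_ofReal ?_
          rw [integral_sub hD (hG n)]
          linarith [hint n]
      _ = ENNReal.ofReal (∫ x, D x ∂μ) := by
          have := ENNReal.tendsto_ofReal (ha.const_add (∫ x, D x ∂μ))
          rw [add_zero] at this
          exact this.liminf_eq
  rw [lintegral_add_left' hDm.ennreal_ofReal, ofReal_integral_eq_lintegral_ofReal hD
    (Eventually.of_forall hD0)] at key
  have hfin : ∫⁻ x, ENNReal.ofReal (D x) ∂μ ≠ ⊤ := by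
    rw [← ofReal_integral_eq_lintegral_ofReal hD (Eventually.of_forall hD0)]
    exact ENNReal.ofReal_ne_top
  have hzero : ∫⁻ x, ENNReal.ofReal (-G₀ x) ∂μ = 0 := by
    have h2 : ∫⁻ x, ENNReal.ofReal (D x) ∂μ + ∫⁻ x, ENNReal.ofReal (-G₀ x) ∂μ ≤
        ∫⁻ x, ENNReal.ofReal (D x) ∂μ + 0 := by rwa [add_zero]
    exact nonpos_iff_eq_zero.1 ((ENNReal.add_le_add_iff_left hfin).1 h2)
  have hnm : AEMeasurable (fun x => ENNReal.ofReal (-G₀ x)) μ := hG₀m.neg.ennreal_ofReal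
  rw [lintegral_eq_zero_iff' hnm] at hzero
  filter_upwards [hzero, hG₀] with x hx h0
  have := ENNReal.ofReal_eq_zero.1 hx
  linarith

end Limit

theorem proposition2p3 (d : ℕ) (hd : 1 ≤ d) (p s : ℝ) (hp : 1 < p) (hs0 : 0 < s) (hs1 : s < 1)
    (Ω : Set (EuclideanSpace ℝ (Fin d))) (hΩo : IsOpen Ω) (hΩc : IsConnected Ω)
    (hΩb : Bornology.IsBounded Ω)
    (u : EuclideanSpace ℝ (Fin d) → ℝ) (hu : MemW1p0 p Ω u) (hu0 : 0 ≤ᵐ[volume] u)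
    (hsuper : IsWeakSupersolution p s Ω u) :
    u =ᵐ[volume] 0 ∨ ∀ᵐ x ∂(volume.restrict Ω), 0 < u x := by
  obtain ⟨η, hηs, hη, hηr⟩ := hΩo.exists_contDiff_support_eq (n := ⊤)
  have hηn : ∀ x, 0 ≤ η x := fun x => (hηr ⟨x, rfl⟩).1
  have hη0 : ∀ x, x ∉ Ω → η x = 0 := fun x hx => by
    rwa [← hηs, Function.notMem_support] at hx
  have hηpos : ∀ x ∈ Ω, 0 < η x := fun x hx =>
    (hηn x).lt_of_ne' (by rwa [← hηs, Function.mem_support] at hx)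
  have hηc : HasCompactSupport η := by
    rw [HasCompactSupport, tsupport, hηs]
    exact hΩb.isCompact_closure
  have hηW : MemW1p0 p Ω η := memW1p0_of_contDiff hη hηc hη0
  have hφW := hu.mul_spike hp hΩb hη hηc hη0
  set μ : Measure (EuclideanSpace ℝ (Fin d)) := volume
  have hu0fst : ∀ᵐ z ∂(μ.prod μ), 0 ≤ u z.1 := Measure.quasiMeasurePreserving_fst.ae hu0
  have hu0snd : ∀ᵐ z ∂(μ.prod μ), 0 ≤ u z.2 := Measure.quasiMeasurePreserving_snd.ae hu0
  have hlim := ae_eq_zero_of_tendsto_of_le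
    (G := fun n (z : EuclideanSpace ℝ (Fin d) × EuclideanSpace ℝ (Fin d)) =>
      |u z.1 - u z.2| ^ (p - 2) * (u z.1 - u z.2) / ‖z.1 - z.2‖ ^ ((d : ℝ) + p * s) *
        (η z.1 * spike n (u z.1) - η z.2 * spike n (u z.2)))
    (G₀ := fun z => |u z.1 - u z.2| ^ (p - 2) * (u z.1 - u z.2) /
      ‖z.1 - z.2‖ ^ ((d : ℝ) + p * s) *
        (η z.1 * (if u z.1 = 0 then 1 else 0) - η z.2 * (if u z.2 = 0 then 1 else 0)))
    (hu.integrable_nonlocal hd hp hs0 hs1 hΩb hηW).abs (fun z => abs_nonneg _)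
    (fun n => hu.integrable_nonlocal hd hp hs0 hs1 hΩb (hφW n))
    (fun n => by
      filter_upwards [hu0fst, hu0snd] with z h1 h2
      exact nonlocal_mul_spike_le (by positivity) h1 h2 (hηn _) n)
    (Filter.Eventually.of_forall fun z =>
      (((tendsto_spike _).const_mul _).sub ((tendsto_spike _).const_mul _)).const_mul _)
    (by
      filter_upwards [hu0fst, hu0snd] with z h1 h2
      by_cases hx : u z.1 = 0 <;> by_cases hy : u z.2 = 0
      · simp [hx, hy]
      · simp only [hx, hy, if_true, if_false, mul_one, mul_zero, sub_zero, zero_sub]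
        refine mul_nonpos_of_nonpos_of_nonneg (div_nonpos_of_nonpos_of_nonneg ?_ (by positivity))
          (hηn _)
        exact mul_nonpos_of_nonneg_of_nonpos (by positivity) (neg_nonpos.2 h2)
      · simp only [hx, hy, if_true, if_false, mul_one, mul_zero, sub_zero, zero_sub]
        refine mul_nonpos_of_nonneg_of_nonpos ?_ (neg_nonpos.2 (hηn _))
        positivity
      · simp [hx, hy])
    (tendsto_setIntegral_local_spike hp hΩb hu hηW)
    (fun n => by
      have h1 := hsuper _ (hφW n)
        (Filter.Eventually.of_forall fun x => mul_nonneg (hηn x) (spike_pos n _).le)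
      rw [mixedForm_eq hd hp hs0 hs1 hΩb hu (hφW n)] at h1
      linarith [setIntegral_local_mul_spike_le hp hΩb hu hu0 hη hηc hη0 hηn n])
  have hnull : ∀ᵐ z ∂(μ.prod μ),
      z.1 ∈ Ω → u z.1 = 0 → ¬ 0 < u z.2 := by
    filter_upwards [hlim] with z hz hzΩ hz1 hz2
    -- Off the diagonal the kernel is not the junk value `_ / 0`.
    have hne : z.1 ≠ z.2 := fun h => by rw [← h, hz1] at hz2; exact lt_irrefl _ hz2
    have hk : 0 < ‖z.1 - z.2‖ ^ ((d : ℝ) + p * s) :=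
      Real.rpow_pos_of_pos (norm_pos_iff.2 (sub_ne_zero.2 hne)) _
    have hη1 := hηpos _ hzΩ
    rw [hz1, if_pos rfl, if_neg hz2.ne', mul_one, mul_zero, sub_zero, zero_sub, abs_neg,
      abs_of_pos hz2, mul_neg, neg_div, neg_mul, neg_eq_zero] at hz
    have : 0 < u z.2 ^ (p - 2) * u z.2 / ‖z.1 - z.2‖ ^ ((d : ℝ) + p * s) * η z.1 := by positivity
    exact this.ne' hz
  have hae := Measure.ae_ae_of_ae_prod hnull
  by_cases hpos : ∀ᵐ x ∂μ, x ∈ Ω → u x ≠ 0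
  · right
    rw [ae_restrict_iff' hΩo.measurableSet]
    filter_upwards [hpos, hu0] with x h1 h2 hx
    exact h2.lt_of_ne' (h1 hx)
  · left
    obtain ⟨x, hx1, hx2⟩ := ((Filter.not_eventually.1 hpos).and_eventually hae).exists
    push Not at hx1
    filter_upwards [hx2, hu0] with y h1 h2
    exact le_antisymm (not_lt.1 (h1 hx1.1 hx1.2)) h2
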